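/- Let $A$ be an $m\times n$ real matrix, $b\in\mathbb{R}^m$ with $b\neq 0$, and $c\in\mathbb{R}^n$ with $c\geq 0$, such that the matrix $(A,b)$ is totally unimodular. For real $t\ge 0$ let $P(t)$ be the linear program of minimizing $c x$ subject to $Ax=t\,b$, $0\le x\le 1$. Let $k$ be a positive integer such that $P(k)$ is monopoly-free: for every $j$ there is a feasible solution $x$ of $P(k)$ with $x_j=0$. Given a binary optimal solution $x^*$ of $P(k)$, the max benchmark problem of $P(k)$ is to maximize $\sum_{j:\,x^*_j=1} z_j$ over all $z\in\mathbb{R}^n$ such that (1) $z_j\ge c_j$ whenever $x^*_j=1$, and $z_j=c_j$ whenever $x^*_j=0$; (2) $z x^*\le z x$ for every binary feasible solution $x$ of $P(k)$; (3) for every $j$ there is a binary feasible solution $x$ of $P(k)$ with $x_j=0$ and $z x^*=z x$. Let $x^*$ be a binary optimal solution of $P(k)$, and let $\mu(k)$ be the optimal value of the max benchmark problem of $P(k)$ for $x^*$. Let $\bar x$ be a binary optimal solution of $P(k+1)$, and let the pruned problem $\tilde P(k)$ be obtained from $P(k)$ by keeping only the columns (with their costs) in $J=\{j:\bar x_j=1\}$.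 Let $\tilde\mu(k)$ be the optimal value of the max benchmark problem of $\tilde P(k)$. Then the maximum $\mu(k)$ is attained, $\tilde P(k)$ has a binary optimal solution, the maximum $\tilde\mu(k)$ is attained and is the same for every choice of the binary optimal solution of $\tilde P(k)$, and $$\tilde\mu(k)\;\le\;\mu(k)\;\le\;(k+1)\,\tilde\mu(k).$$ -/

import Mathlib

open Matrix

noncomputable section

/-- The data of a first price set system auction: a constraint matrix with rows `m` and
columns (agents) `n`, a right-hand side and a vector of costs. -/
structure SetAuction (m n : Type*) where
  /-- the constraint matrix -/
  A : Matrix m n ℝ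
  /-- the right-hand side -/
  b : m → ℝ
  /-- the costs -/
  c : n → ℝ

namespace SetAuction

variable {m n : Type*} [Fintype n]

/-- The matrix `(A, b)`, obtained by appending the column `b` to `A`. -/
def extendedMatrix (P : SetAuction m n) : Matrix m (n ⊕ Unit) ℝ :=
  Matrix.fromCols P.A (Matrix.replicateCol Unit P.b)

/-- `x` is feasible for the linear program `P(t)`: minimize `c x` subject to
`A x = t b`, `0 ≤ x ≤ 1`. -/
def IsFeasible (P : SetAuction m n) (t : ℝ) (x : n → ℝ) : Prop :=
  P.A *ᵥ x = t • P.b ∧ ∀ j, 0 ≤ x j ∧ x j ≤ 1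

/-- `x` has all entries in `{0, 1}`. -/
def IsBinary (x : n → ℝ) : Prop :=
  ∀ j, x j = 0 ∨ x j = 1

/-- `x` is an optimal solution of the linear program `P(t)`, with respect to all its feasible
solutions, fractional ones included. -/
def IsOptimal (P : SetAuction m n) (t : ℝ) (x : n → ℝ) : Prop :=
  P.IsFeasible t x ∧ ∀ y, P.IsFeasible t y → P.c ⬝ᵥ x ≤ P.c ⬝ᵥ y

/-- `P(t)` is monopoly-free: no agent is used by all feasible solutions. -/
def MonopolyFree (P : SetAuction m n) (t : ℝ) : Prop :=
  ∀ j, ∃ x, P.IsFeasible t x ∧ x j = 0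

/-- The requirements of the benchmark problems on the prices `z`, for the (binary) optimal
solution `xs` of `P(t)`. -/
structure IsBenchmarkPrice (P : SetAuction m n) (t : ℝ) (xs z : n → ℝ) : Prop where
  /-- prices of winning agents do not decrease -/
  winners : ∀ j, xs j = 1 → P.c j ≤ z j
  /-- prices of losing agents do not change -/
  losers : ∀ j, xs j = 0 → z j = P.c j
  /-- `xs` stays optimal among the binary feasible solutions -/
  stable : ∀ x, P.IsFeasible t x → IsBinary x → z ⬝ᵥ xs ≤ z ⬝ᵥ x
  /-- every agent can be avoided at the same price -/
  tight : ∀ j, ∃ x, P.IsFeasible t x ∧ IsBinary x ∧ x j = 0 ∧ z ⬝ᵥ xs = z ⬝ᵥ x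

/-- The set of objective values of the benchmark problems: the total prices paid to the
winning agents. The value of the max benchmark problem is the greatest element of this set. -/
def benchmarkValues (P : SetAuction m n) (t : ℝ) (xs : n → ℝ) : Set ℝ :=
  {v | ∃ z, P.IsBenchmarkPrice t xs z ∧ v = ∑ j with xs j = 1, z j}

/-- The pruned auction: only the columns `j` with `x j = 1` are kept. -/
def pruned (P : SetAuction m n) (x : n → ℝ) : SetAuction m {j : n // x j = 1} where
  A := P.A.submatrix id Subtype.val
  b := P.b
  c := fun j => P.c j.val

end SetAuction

end

/-! Everything follows from a closed formula: the max benchmark of P(k) equals k·δ, where δ is the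
growth of the optimal cost from P(k) to P(k+1) (`isGreatest_benchmarkValues`).

Total unimodularity of (A, b) allows x and t to be rounded together, so the optimal cost on [k, k+1]
lies above the chord through its endpoints (`interpolation_le_cost`). By Farkas this gives row
potentials u with u·b ≥ δ, and the prices max(c, uA) attain k·δ (`mem_benchmarkValues`). Conversely,
averaging tight solutions gives a point of the optimal face with room to move towards `xb`, which
caps every benchmark price vector (`benchmarkValues_le`).

In the pruned auction the all-ones vector is optimal for k+1 at the same cost, so the two benchmarks
differ only through the optimal costs at k. Pruning cannot lower that cost, and the constant vector
k/(k+1) bounds the pruned one; these give the two inequalities. -/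

/-! ### Farkas' lemma and linear inequalities. -/

open Finset in
/-- **Farkas' lemma** for finitely many linear functionals on a real vector space. -/
theorem exists_nonneg_sum_smul_eq {V ι : Type*} [AddCommGroup V] [Module ℝ V] (s : Finset ι)
    (a : ι → V →ₗ[ℝ] ℝ) (c : V →ₗ[ℝ] ℝ)
    (h : ∀ u, (∀ i ∈ s, a i u ≤ 0) → c u ≤ 0) :
    ∃ l : ι → ℝ, (∀ i, 0 ≤ l i) ∧ c = ∑ i ∈ s, l i • a i := by
  classical
  induction s using Finset.induction_on generalizing a c with
  | empty =>
    refine ⟨0, fun _ => le_rfl, ?_⟩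
    ext u
    have h₁ := h u (by simp)
    have h₂ := h (-u) (by simp)
    simp only [map_neg] at h₂
    simp only [sum_empty, LinearMap.zero_apply]
    linarith
  | insert e s he ih =>
    by_cases hs : ∀ u, (∀ i ∈ s, a i u ≤ 0) → c u ≤ 0
    · obtain ⟨l, hl, hc⟩ := ih a c hs
      refine ⟨Function.update l e 0, fun i => ?_, ?_⟩
      · by_cases hi : i = e
        · simp [hi]
        · simpa [hi] using hl i
      · rw [sum_insert he, Function.update_self, zero_smul, zero_add, hc]
        refine sum_congr rfl fun i hi => ?_
        rw [Function.update_of_ne (by rintro rfl; exact he hi)]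
    · push Not at hs
      obtain ⟨u, hu, hcu⟩ := hs
      have hpos : 0 < a e u := by
        by_contra hle
        exact absurd (h u (by
          intro i hi
          rcases mem_insert.1 hi with rfl | hi
          · exact not_lt.1 hle
          · exact hu i hi)) (not_le.2 hcu)
      let w : V := (a e u)⁻¹ • u
      have hw : a e w = 1 := by simp [w, hpos.ne']
      have hsw : ∀ i ∈ s, a i w ≤ 0 := fun i hi => by
        simpa [w] using mul_nonpos_of_nonneg_of_nonpos (inv_nonneg.2 hpos.le) (hu i hi)
      have hcw : 0 ≤ c w := by
        simpa [w] using mul_nonneg (inv_nonneg.2 hpos.le) hcu.le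
      -- Precomposing with the projection v ↦ v - a e v • w onto ker (a e) eliminates the constraint
      -- e; its multiplier is recovered below by evaluating at w.
      obtain ⟨l, hl, hc⟩ := ih (fun i => a i - a i w • a e) (c - c w • a e) (by
        intro v hv
        have := h (v - a e v • w) (by
          intro i hi
          rcases mem_insert.1 hi with rfl | hi
          · simp [hw]
          · have := hv i hi
            simp only [LinearMap.sub_apply, LinearMap.smul_apply, smul_eq_mul, map_sub,
              map_smul] at this ⊢
            linarith)
        simp only [LinearMap.sub_apply, LinearMap.smul_apply, smul_eq_mul, map_sub,
          map_smul] at this ⊢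
        linarith)
      have hcoef : 0 ≤ c w - ∑ i ∈ s, l i * a i w := by
        have : ∑ i ∈ s, l i * a i w ≤ 0 :=
          sum_nonpos fun i hi => mul_nonpos_of_nonneg_of_nonpos (hl i) (hsw i hi)
        linarith
      refine ⟨Function.update l e (c w - ∑ i ∈ s, l i * a i w), fun i => ?_, ?_⟩
      · by_cases hi : i = e
        · simpa [hi] using hcoef
        · simpa [hi] using hl i
      · rw [sum_insert he, Function.update_self]
        have hsum : ∑ i ∈ s, Function.update l e (c w - ∑ i ∈ s, l i * a i w) i • a i =
            ∑ i ∈ s, l i • a i :=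
          sum_congr rfl fun i hi => by
            rw [Function.update_of_ne (by rintro rfl; exact he hi)]
        rw [hsum]
        ext v
        have hv := LinearMap.congr_fun hc v
        simp only [LinearMap.sub_apply, LinearMap.smul_apply, smul_eq_mul, LinearMap.sum_apply,
          LinearMap.add_apply, mul_sub, sum_sub_distrib] at hv ⊢
        have : ∑ i ∈ s, l i * (a i w * a e v) = (∑ i ∈ s, l i * a i w) * a e v := by
          rw [sum_mul]; exact sum_congr rfl fun i _ => by ring
        rw [this] at hv
        linarith

/-- Feasibility of a system of linear inequalities: `u A ≤ c` is solvable if every nonnegative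
`y` with `A y = 0` satisfies `0 ≤ c y`. -/
theorem Matrix.exists_vecMul_le {m n : Type*} [Fintype m] [Fintype n] (A : Matrix m n ℝ)
    (c : n → ℝ) (h : ∀ y : n → ℝ, (∀ j, 0 ≤ y j) → A *ᵥ y = 0 → 0 ≤ c ⬝ᵥ y) :
    ∃ u : m → ℝ, ∀ j, (u ᵥ* A) j ≤ c j := by
  classical
  by_contra! hno
  let a : n → (m → ℝ) × ℝ →ₗ[ℝ] ℝ := fun j =>
    (LinearMap.proj j ∘ₗ A.vecMulLinear) ∘ₗ LinearMap.fst ℝ _ _ - c j • LinearMap.snd ℝ _ _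
  have ha : ∀ j v, a j v = (v.1 ᵥ* A) j - c j * v.2 := fun j v => by simp [a]
  obtain ⟨l, hl, hsum⟩ := exists_nonneg_sum_smul_eq Finset.univ a (LinearMap.snd ℝ _ _) (by
    rintro ⟨u, t⟩ hu
    by_contra! ht
    simp only [LinearMap.snd_apply] at ht
    obtain ⟨j, hj⟩ := hno (t⁻¹ • u)
    have := hu j (Finset.mem_univ j)
    rw [ha] at this
    rw [smul_vecMul, Pi.smul_apply, smul_eq_mul, lt_inv_mul_iff₀ ht] at hj
    simp only at this
    linarith)
  have key : ∀ u t, t = ∑ j, l j * ((u ᵥ* A) j - c j * t) := fun u t => by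
    have := LinearMap.congr_fun hsum (u, t)
    simpa [ha] using this
  have h0 := h l hl (by
    ext i
    have := key (Pi.single i 1) 0
    simp only [single_one_vecMul, mul_zero, sub_zero] at this
    simp only [mulVec, dotProduct, Pi.zero_apply]
    rw [this]
    exact Finset.sum_congr rfl fun j _ => mul_comm _ _)
  have h1 := key 0 1
  simp only [zero_vecMul, Pi.zero_apply, mul_one, zero_sub, mul_neg,
    Finset.sum_neg_distrib] at h1
  have : c ⬝ᵥ l = ∑ j, l j * c j := by
    simp only [dotProduct]
    exact Finset.sum_congr rfl fun j _ => mul_comm _ _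
  linarith

/-! ### Rounding for totally unimodular systems. -/

/-- If the columns of a totally unimodular matrix are linearly independent, then a vector whose
image is integral is integral. -/
theorem Matrix.IsTotallyUnimodular.exists_int_eq {m n : Type*} [Fintype n]
    {A : Matrix m n ℝ} (hA : A.IsTotallyUnimodular)
    (hinj : ∀ d, A *ᵥ d = 0 → d = 0) (x : n → ℝ) (hx : ∀ i, ∃ z : ℤ, (A *ᵥ x) i = z) :
    ∀ j, ∃ z : ℤ, x j = z := by
  classical
  obtain ⟨κ, e, -, hspan, hli⟩ := exists_linearIndependent' ℝ A.row
  have : Finite κ := hli.finite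
  have : Fintype κ := Fintype.ofFinite κ
  have htop : Submodule.span ℝ (Set.range (A.row ∘ e)) = ⊤ := by
    rw [hspan]
    -- A nonzero functional vanishing on all rows would be a nonzero kernel vector of A.
    by_contra hne
    obtain ⟨f, hf, hker⟩ := Submodule.exists_le_ker_of_lt_top _ (lt_top_iff_ne_top.2 hne)
    apply hf
    have hd : ∀ v, f v = v ⬝ᵥ fun j => f (Pi.single j 1) := fun v => by
      conv_lhs => rw [pi_eq_sum_univ' v]
      simp [dotProduct]
    have hz := hinj (fun j => f (Pi.single j 1)) (by
      ext i
      rw [mulVec, ← hd]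
      exact hker (Submodule.subset_span ⟨i, rfl⟩))
    ext j
    simpa using congrFun hz j
  let bs : Module.Basis κ ℝ (n → ℝ) := Module.Basis.mk hli htop.ge
  let σ : n ≃ κ := (Pi.basisFun ℝ n).indexEquiv bs
  let B : Matrix n n ℝ := A.submatrix (e ∘ σ) id
  have hBinj : IsUnit B := by
    rw [← linearIndependent_rows_iff_isUnit]
    exact hli.comp σ σ.injective
  have hdet : B.det = 1 ∨ B.det = -1 := by
    have h0 : B.det ≠ 0 := ((isUnit_iff_isUnit_det B).1 hBinj).ne_zero
    obtain ⟨s, hs⟩ := (isTotallyUnimodular_iff_fintype A).1 hA n (e ∘ σ) id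
    change _ = B.det at hs
    cases s <;> simp_all
  have hint : ∀ i j, ∃ z : ℤ, (z : ℝ) = B i j := fun i j => by
    obtain ⟨s, hs⟩ := hA.apply (e (σ i)) j
    exact ⟨s, by rw [SignType.intCast_cast]; exact hs⟩
  choose C hC using hint
  choose z hz using hx
  have hCB : B = (Int.castRingHom ℝ).mapMatrix (Matrix.of C) := by
    ext i j; simp [hC]
  have hadj : B.adjugate *ᵥ (B *ᵥ x) = B.det • x := by
    rw [mulVec_mulVec, adjugate_mul, smul_mulVec, one_mulVec]
  have hBx : B *ᵥ x = fun i => (z (e (σ i)) : ℝ) := by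
    ext i
    exact hz (e (σ i))
  have hval : ∀ j, ∃ w : ℤ, (B.det • x) j = w := fun j => by
    refine ⟨((Matrix.of C).adjugate *ᵥ fun i => z (e (σ i))) j, ?_⟩
    rw [← hadj, hBx, hCB, ← RingHom.map_adjugate]
    simp [mulVec, dotProduct]
  intro j
  obtain ⟨w, hw⟩ := hval j
  rcases hdet with h | h
  · exact ⟨w, by simpa [h] using hw⟩
  · refine ⟨-w, ?_⟩
    simp only [h, Pi.smul_apply, smul_eq_mul] at hw
    push_cast
    linarith

open Classical in
/-- A non-integral vector with integral image under a totally unimodular matrix admits a nonzero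
kernel direction supported on its fractional coordinates. -/
theorem Matrix.IsTotallyUnimodular.exists_mulVec_eq_zero {m n : Type*} [Fintype n]
    {A : Matrix m n ℝ} (hA : A.IsTotallyUnimodular) (x : n → ℝ)
    (hx : ∀ i, ∃ z : ℤ, (A *ᵥ x) i = z) (hfrac : ∃ j, ∀ z : ℤ, x j ≠ z) :
    ∃ d : n → ℝ, d ≠ 0 ∧ A *ᵥ d = 0 ∧ ∀ j, (∃ z : ℤ, x j = z) → d j = 0 := by
  by_contra! hno
  let F := {j // ∀ z : ℤ, x j ≠ z}
  let B : Matrix m F ℝ := A.submatrix id Subtype.val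
  have hsplit : ∀ v i, (A *ᵥ v) i =
      (B *ᵥ fun j => v j.1) i + ∑ j : {j // ¬ ∀ z : ℤ, x j ≠ z}, A i j * v j := fun v i =>
    (Fintype.sum_subtype_add_sum_subtype (fun j => ∀ z : ℤ, x j ≠ z) fun j => A i j * v j).symm
  have hB : ∀ d, B *ᵥ d = 0 → d = 0 := by
    intro d hd
    by_contra hne
    let v : n → ℝ := fun j => if h : ∀ z : ℤ, x j ≠ z then d ⟨j, h⟩ else 0
    have hv : (fun j : F => v j.1) = d := by
      ext j; simp [v, j.2]
    obtain ⟨j, ⟨z, hz⟩, hj⟩ := hno v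
      (fun h0 => hne (by rw [← hv, h0]; rfl)) (by
        ext i
        rw [hsplit, hv, hd, Pi.zero_apply, zero_add]
        refine Finset.sum_eq_zero fun j _ => ?_
        simp only [v, dif_neg j.2, mul_zero])
    exact hj (dif_neg fun h => h z hz)
  obtain ⟨j, hj⟩ := hfrac
  have hR : ∀ r : ℝ, (∃ z : ℤ, r = z) ↔ r ∈ (Int.castRingHom ℝ).range := fun r =>
    ⟨fun ⟨z, hz⟩ => ⟨z, hz.symm⟩, fun ⟨z, hz⟩ => ⟨z, hz.symm⟩⟩
  -- With the fractional columns independent, subtracting the integral coordinates' contribution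
  -- leaves an integral image, so the fractional coordinates would be integral.
  obtain ⟨z, hz⟩ := (hA.submatrix id Subtype.val : B.IsTotallyUnimodular).exists_int_eq hB
    (fun j => x j.1) (by
      intro i
      have : (B *ᵥ fun j => x j.1) i =
          (A *ᵥ x) i - ∑ j : {j // ¬ ∀ z : ℤ, x j ≠ z}, A i j * x j := by
        rw [hsplit]; ring
      rw [this, hR]
      refine sub_mem ((hR _).1 (hx i)) (sum_mem fun j _ => mul_mem ?_ ((hR _).1 ?_))
      · obtain ⟨s, hs⟩ := hA.apply i j.1
        exact ⟨s, by rw [← hs]; simp⟩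
      · simpa using j.2) ⟨j, hj⟩
  exact hj z hz

open Classical in
/-- One step of the rounding: moving along a kernel direction until a further coordinate becomes
integral. -/
theorem exists_step_to_int {n : Type*} [Fintype n] (x d : n → ℝ) (hd : d ≠ 0)
    (hsupp : ∀ j, (∃ z : ℤ, x j = z) → d j = 0) :
    ∃ ε : ℝ, 0 < ε ∧ (∀ j, ⌊x j⌋ ≤ x j + ε * d j ∧ x j + ε * d j ≤ ⌈x j⌉) ∧
      ∃ j, (∀ z : ℤ, x j ≠ z) ∧ ∃ z : ℤ, x j + ε * d j = z := by
  -- Ratio test: r j is the step at which a moving coordinate j meets its ceiling or floor; the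
  -- least such step is taken.
  let r : n → ℝ := fun j => if 0 < d j then (⌈x j⌉ - x j) / d j else (⌊x j⌋ - x j) / d j
  obtain ⟨j₀, hj₀⟩ := Function.ne_iff.1 hd
  obtain ⟨j, hj, hmin⟩ := Finset.exists_min_image {j | d j ≠ 0} r ⟨j₀, by simpa using hj₀⟩
  simp only [Finset.mem_filter, Finset.mem_univ, true_and] at hj hmin
  have hfr : ∀ i, d i ≠ 0 → ∀ z : ℤ, x i ≠ z := fun i hi z hz => hi (hsupp i ⟨z, hz⟩)
  have hlt : ∀ i, d i ≠ 0 → (⌊x i⌋ : ℝ) < x i ∧ x i < ⌈x i⌉ := fun i hi =>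
    ⟨lt_of_le_of_ne (Int.floor_le _) (hfr i hi _).symm,
      lt_of_le_of_ne (Int.le_ceil _) (hfr i hi _)⟩
  have hpos : 0 < r j := by
    obtain ⟨h₁, h₂⟩ := hlt j hj
    by_cases h : 0 < d j
    · simp only [r, if_pos h]
      exact div_pos (by linarith) h
    · simp only [r, if_neg h]
      exact div_pos_of_neg_of_neg (by linarith) (lt_of_le_of_ne (not_lt.1 h) hj)
  refine ⟨r j, hpos, fun i => ?_, j, hfr j hj, ?_⟩
  · have hf := Int.floor_le (x i)
    have hc := Int.le_ceil (x i)
    by_cases hi : d i = 0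
    · simp [hi, hf, hc]
    have hle := hmin i hi
    by_cases h : 0 < d i
    · simp only [r, if_pos h] at hle
      rw [le_div_iff₀ h] at hle
      have := mul_pos hpos h
      constructor
      · linarith
      · simp only [r] at this ⊢; linarith
    · have h' : d i < 0 := lt_of_le_of_ne (not_lt.1 h) hi
      have hle' : r j ≤ (⌊x i⌋ - x i) / d i := by simpa only [r, if_neg h] using hle
      rw [le_div_iff_of_neg h'] at hle'
      have := mul_neg_of_pos_of_neg hpos h'
      constructor <;> linarith
  · by_cases h : 0 < d j
    · refine ⟨⌈x j⌉, ?_⟩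
      simp only [r, if_pos h]
      field_simp
      ring
    · refine ⟨⌊x j⌋, ?_⟩
      simp only [r, if_neg h]
      field_simp
      ring

open Classical in
/-- Rounding for totally unimodular systems: a vector with integral image can be rounded to an
integral vector with the same image, without increasing a given linear cost. -/
theorem Matrix.IsTotallyUnimodular.exists_int_rounding {m n : Type*} [Fintype n]
    {A : Matrix m n ℝ} (hA : A.IsTotallyUnimodular) (v : n → ℝ) (x : n → ℝ)
    (hx : ∀ i, ∃ z : ℤ, (A *ᵥ x) i = z) :
    ∃ y : n → ℤ, (A *ᵥ fun j => (y j : ℝ)) = A *ᵥ x ∧ (∀ j, ⌊x j⌋ ≤ y j ∧ y j ≤ ⌈x j⌉) ∧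
      (v ⬝ᵥ fun j => (y j : ℝ)) ≤ v ⬝ᵥ x := by
  induction hN : Finset.card {j | ∀ z : ℤ, x j ≠ z} using Nat.strong_induction_on
    generalizing x with
  | _ N ih =>
  by_cases hfrac : ∃ j, ∀ z : ℤ, x j ≠ z
  · obtain ⟨d, hd, hAd, hsupp, hvd⟩ : ∃ d : n → ℝ, d ≠ 0 ∧ A *ᵥ d = 0 ∧
        (∀ j, (∃ z : ℤ, x j = z) → d j = 0) ∧ v ⬝ᵥ d ≤ 0 := by
      obtain ⟨d, hd, hAd, hsupp⟩ := hA.exists_mulVec_eq_zero x hx hfrac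
      rcases le_total (v ⬝ᵥ d) 0 with h | h
      · exact ⟨d, hd, hAd, hsupp, h⟩
      · exact ⟨-d, neg_ne_zero.2 hd, by rw [mulVec_neg, hAd, neg_zero],
          fun j hj => by simp [hsupp j hj], by simpa using h⟩
    obtain ⟨ε, hε, hbd, j, hj, hjz⟩ := exists_step_to_int x d hd hsupp
    have himg : A *ᵥ (x + ε • d) = A *ᵥ x := by
      rw [mulVec_add, mulVec_smul, hAd, smul_zero, add_zero]
    obtain ⟨y, hy₁, hy₂, hy₃⟩ := ih _ (by
        rw [← hN]
        refine Finset.card_lt_card (Finset.ssubset_iff_of_subset ?_ |>.2 ⟨j, ?_, ?_⟩)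
        · intro i
          simp only [Finset.mem_filter, Finset.mem_univ, true_and]
          intro hi z hz
          refine hi z ?_
          simp [hsupp i ⟨z, hz⟩, hz]
        · simpa using hj
        · simpa using hjz) (x + ε • d) (by rwa [himg]) rfl
    refine ⟨y, hy₁.trans himg, fun i => ⟨?_, ?_⟩, hy₃.trans ?_⟩
    · exact (Int.le_floor.2 (hbd i).1).trans (hy₂ i).1
    · exact (hy₂ i).2.trans (Int.ceil_le.2 (hbd i).2)
    · rw [dotProduct_add, dotProduct_smul, smul_eq_mul]
      have := mul_nonpos_of_nonneg_of_nonpos hε.le hvd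
      linarith
  · push Not at hfrac
    choose y hy using hfrac
    have : (fun j => (y j : ℝ)) = x := funext fun j => (hy j).symm
    exact ⟨y, by rw [this], fun j => by simp [hy j], by rw [this]⟩

/-! ### Binary solutions and the optimal cost as a function of t. -/

namespace SetAuction

theorem pruned_isTotallyUnimodular {m n : Type*} (P : SetAuction m n)
    (hTU : P.extendedMatrix.IsTotallyUnimodular) (x : n → ℝ) :
    (P.pruned x).extendedMatrix.IsTotallyUnimodular := by
  have : (P.pruned x).extendedMatrix =
      P.extendedMatrix.submatrix id (Sum.map Subtype.val id) := by
    ext i j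
    rcases j with j | j <;> rfl
  rw [this]
  exact hTU.submatrix _ _

variable {m n : Type*} [Fintype n]

theorem extendedMatrix_mulVec_elim (P : SetAuction m n) (x : n → ℝ) (t : ℝ) :
    P.extendedMatrix *ᵥ Sum.elim x (fun _ => -t) = P.A *ᵥ x - t • P.b := by
  rw [extendedMatrix, fromCols_mulVec, Sum.elim_comp_inl, Sum.elim_comp_inr]
  ext i
  simp [mulVec, dotProduct]
  ring

/-- Rounding a feasible solution of `P(t)`, with `t` varying along. -/
theorem exists_binary_rounding (P : SetAuction m n)
    (hTU : P.extendedMatrix.IsTotallyUnimodular) {t : ℝ} {x : n → ℝ} (hx : P.IsFeasible t x)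
    (v : n → ℝ) (δ : ℝ) :
    ∃ (s : ℤ) (y : n → ℝ), P.IsFeasible s y ∧ IsBinary y ∧ ⌊t⌋ ≤ s ∧ s ≤ ⌈t⌉ ∧
      (∀ j, x j = 0 → y j = 0) ∧ v ⬝ᵥ y - δ * s ≤ v ⬝ᵥ x - δ * t := by
  -- Feasibility says that (A, b) sends (x, -t) to 0, so t is rounded as one more coordinate.
  obtain ⟨w, hw₁, hw₂, hw₃⟩ := hTU.exists_int_rounding (Sum.elim v fun _ => δ)
    (Sum.elim x fun _ => -t) fun i => ⟨0, by
      rw [extendedMatrix_mulVec_elim, hx.1, sub_self]; simp⟩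
  have hsplit : (fun j => (w j : ℝ)) =
      Sum.elim (fun j => (w (.inl j) : ℝ)) fun _ => -((-w (.inr ()) : ℤ) : ℝ) := by
    ext j
    rcases j with j | j <;> simp
  rw [hsplit, extendedMatrix_mulVec_elim, extendedMatrix_mulVec_elim, hx.1, sub_self,
    sub_eq_zero] at hw₁
  rw [hsplit, sumElim_dotProduct_sumElim, sumElim_dotProduct_sumElim] at hw₃
  have hbin : ∀ j, (w (.inl j)) = 0 ∨ (w (.inl j)) = 1 := fun j => by
    have h₁ : 0 ≤ ⌊x j⌋ := Int.floor_nonneg.2 (hx.2 j).1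
    have h₂ : ⌈x j⌉ ≤ 1 := Int.ceil_le.2 (by simpa using (hx.2 j).2)
    have := hw₂ (.inl j)
    simp only [Sum.elim_inl] at this
    omega
  have hbin' : IsBinary fun j => (w (.inl j) : ℝ) := fun j => by
    rcases hbin j with h | h <;> simp [h]
  refine ⟨-w (.inr ()), fun j => w (.inl j), ⟨hw₁, fun j => ?_⟩, hbin', ?_, ?_, fun j hj => ?_, ?_⟩
  · rcases hbin j with h | h <;> simp [h]
  · have := (hw₂ (.inr ())).2
    simp only [Sum.elim_inr, Int.ceil_neg] at this
    omega
  · have := (hw₂ (.inr ())).1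
    simp only [Sum.elim_inr, Int.floor_neg] at this
    omega
  · have := hw₂ (.inl j)
    simp only [Sum.elim_inl, hj, Int.floor_zero, Int.ceil_zero] at this
    have h0 : w (.inl j) = 0 := le_antisymm this.2 this.1
    simp [h0]
  · simpa [dotProduct, sub_eq_add_neg] using hw₃

theorem exists_binary_le (P : SetAuction m n)
    (hTU : P.extendedMatrix.IsTotallyUnimodular) {k : ℕ} {x : n → ℝ} (hx : P.IsFeasible k x)
    (v : n → ℝ) :
    ∃ y, P.IsFeasible k y ∧ IsBinary y ∧ (∀ j, x j = 0 → y j = 0) ∧ v ⬝ᵥ y ≤ v ⬝ᵥ x := by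
  obtain ⟨s, y, hy, hyb, h₁, h₂, h₃, h₄⟩ := P.exists_binary_rounding hTU hx v 0
  simp only [Int.floor_natCast, Int.ceil_natCast] at h₁ h₂
  obtain rfl := le_antisymm h₂ h₁
  exact ⟨y, by simpa using hy, hyb, h₃, by simpa using h₄⟩

theorem finite_setOf_isBinary : {x : n → ℝ | IsBinary x}.Finite :=
  (Set.Finite.pi' fun _ : n => ({0, 1} : Set ℝ).toFinite).subset fun x hx j => by
    simpa using hx j

theorem exists_binary_isOptimal (P : SetAuction m n)
    (hTU : P.extendedMatrix.IsTotallyUnimodular) {k : ℕ} (h : ∃ x, P.IsFeasible k x) :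
    ∃ x, P.IsOptimal k x ∧ IsBinary x := by
  obtain ⟨x₀, hx₀⟩ := h
  obtain ⟨y₀, hy₀, hyb₀, -⟩ := P.exists_binary_le hTU hx₀ 0
  obtain ⟨x, hx, hmin⟩ := Set.exists_min_image {x : n → ℝ | P.IsFeasible k x ∧ IsBinary x}
    (fun x => P.c ⬝ᵥ x) (finite_setOf_isBinary.subset fun x hx => hx.2) ⟨y₀, hy₀, hyb₀⟩
  refine ⟨x, ⟨hx.1, fun y hy => ?_⟩, hx.2⟩
  obtain ⟨y', hy', hyb', -, hle⟩ := P.exists_binary_le hTU hy P.c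
  exact (hmin y' ⟨hy', hyb'⟩).trans hle

/-- The optimal value of `P(t)` is bounded from below on `[k, k + 1]` by the linear interpolation
of its values at the two ends. -/
theorem interpolation_le_cost (P : SetAuction m n)
    (hTU : P.extendedMatrix.IsTotallyUnimodular) {k : ℕ} {xs xb x : n → ℝ}
    (hxs : P.IsOptimal k xs) (hxb : P.IsOptimal ((k : ℝ) + 1) xb) {s : ℝ} (hs₀ : 0 ≤ s)
    (hs₁ : s ≤ 1) (hx : P.IsFeasible (k + s) x) :
    P.c ⬝ᵥ xs + s * (P.c ⬝ᵥ xb - P.c ⬝ᵥ xs) ≤ P.c ⬝ᵥ x := by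
  obtain ⟨t, y, hy, -, h₁, h₂, -, hle⟩ :=
    P.exists_binary_rounding hTU hx P.c (P.c ⬝ᵥ xb - P.c ⬝ᵥ xs)
  have h₁' : (k : ℤ) ≤ t := (Int.le_floor.2 (by simpa using hs₀)).trans h₁
  have h₂' : t ≤ k + 1 := h₂.trans (Int.ceil_le.2 (by simpa using hs₁))
  obtain rfl | rfl : t = k ∨ t = k + 1 := by omega
  · have := hxs.2 y (by simpa using hy)
    push_cast at hle
    linarith
  · have := hxb.2 y (by simpa using hy)
    push_cast at hle
    linarith

theorem dotProduct_eq_sum_winners {xs : n → ℝ} (hxs : IsBinary xs) (z : n → ℝ) :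
    z ⬝ᵥ xs = ∑ j with xs j = 1, z j := by
  rw [Finset.sum_filter, dotProduct]
  refine Finset.sum_congr rfl fun j _ => ?_
  rcases hxs j with h | h <;> simp [h]

/-! ### Prices attaining k·δ. -/

/-- Potentials of the rows that price the passage from `P(k)` to `P(k + 1)`. -/
theorem exists_potential [Fintype m] (P : SetAuction m n)
    (hTU : P.extendedMatrix.IsTotallyUnimodular) {k : ℕ} {xs xb : n → ℝ}
    (hxs : P.IsOptimal k xs) (hxs_bin : IsBinary xs) (hxb : P.IsOptimal ((k : ℝ) + 1) xb) :
    ∃ u : m → ℝ, (∀ j, xs j = 1 → P.c j ≤ (u ᵥ* P.A) j) ∧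
      (∀ j, xs j = 0 → (u ᵥ* P.A) j ≤ P.c j) ∧ P.c ⬝ᵥ xb - P.c ⬝ᵥ xs ≤ u ⬝ᵥ P.b := by
  obtain ⟨u, hu⟩ := Matrix.exists_vecMul_le
    (Matrix.of fun i (j : n ⊕ Unit) =>
      Sum.elim (fun j => (1 - 2 * xs j) * P.A i j) (fun _ => -P.b i) j)
    (Sum.elim (fun j => (1 - 2 * xs j) * P.c j) fun _ => -(P.c ⬝ᵥ xb - P.c ⬝ᵥ xs)) (by
      intro y hy hAy
      let τ := y (.inr ())
      -- The sign 1 - 2 `xs j` makes d point into the unit box at `xs`; τ is the accompanying change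
      -- of t.
      let d : n → ℝ := fun j => (1 - 2 * xs j) * y (.inl j)
      have hAd : P.A *ᵥ d = τ • P.b := by
        ext i
        have := congrFun hAy i
        simp only [mulVec, dotProduct, of_apply, Fintype.sum_sum_type, Sum.elim_inl, Sum.elim_inr,
          Finset.univ_unique, Finset.sum_singleton, Pi.zero_apply] at this
        simp only [mulVec, dotProduct, d, τ, Pi.smul_apply, smul_eq_mul]
        have hcongr : ∑ j, P.A i j * ((1 - 2 * xs j) * y (.inl j)) =
            ∑ j, (1 - 2 * xs j) * P.A i j * y (.inl j) :=
          Finset.sum_congr rfl fun j _ => by ring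
        rw [hcongr]
        change _ + -P.b i * y (.inr ()) = 0 at this
        linarith
      have hgoal : Sum.elim (fun j => (1 - 2 * xs j) * P.c j)
          (fun _ => -(P.c ⬝ᵥ xb - P.c ⬝ᵥ xs)) ⬝ᵥ y =
          P.c ⬝ᵥ d - τ * (P.c ⬝ᵥ xb - P.c ⬝ᵥ xs) := by
        simp only [dotProduct, Fintype.sum_sum_type, Sum.elim_inl, Sum.elim_inr,
          Finset.univ_unique, Finset.sum_singleton, d]
        have hcongr : ∑ j, P.c j * ((1 - 2 * xs j) * y (.inl j)) =
            ∑ j, (1 - 2 * xs j) * P.c j * y (.inl j) :=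
          Finset.sum_congr rfl fun j _ => by ring
        rw [hcongr]
        change _ + _ * τ = _
        ring
      rw [hgoal]
      have hS : 0 ≤ ∑ j, y j := Finset.sum_nonneg fun j _ => hy j
      -- Small enough that no coordinate leaves the box and t stays in [k, k+1].
      let ε : ℝ := (1 + ∑ j, y j)⁻¹
      have hε : 0 < ε := by positivity
      have hε₁ : ∀ j, ε * y j ≤ 1 := fun j => by
        have := Finset.single_le_sum (fun j _ => hy j) (Finset.mem_univ j)
        rw [inv_mul_le_iff₀ (by positivity)]
        linarith
      have hε₀ : ∀ j, 0 ≤ ε * y j := fun j => mul_nonneg hε.le (hy j)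
      have hfeas : P.IsFeasible (k + ε * τ) (xs + ε • d) := by
        refine ⟨?_, fun j => ?_⟩
        · rw [mulVec_add, mulVec_smul, hAd, hxs.1.1, smul_smul, add_smul]
        · have h₀ := hε₀ (.inl j)
          have h₁ := hε₁ (.inl j)
          simp only [Pi.add_apply, Pi.smul_apply, smul_eq_mul, d]
          rcases hxs_bin j with h | h <;> rw [h] <;> constructor <;> linarith
      have := P.interpolation_le_cost hTU hxs hxb (hε₀ _) (hε₁ _) hfeas
      rw [dotProduct_add, dotProduct_smul, smul_eq_mul] at this
      have h0 : 0 ≤ ε * (P.c ⬝ᵥ d - τ * (P.c ⬝ᵥ xb - P.c ⬝ᵥ xs)) := by linarith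
      exact nonneg_of_mul_nonneg_right h0 hε)
  have hcol : ∀ j, (1 - 2 * xs j) * (u ᵥ* P.A) j ≤ (1 - 2 * xs j) * P.c j := fun j => by
    have := hu (.inl j)
    simp only [vecMul, dotProduct, of_apply, Sum.elim_inl] at this
    simp only [vecMul, dotProduct]
    rw [Finset.mul_sum]
    refine le_trans (le_of_eq (Finset.sum_congr rfl fun i _ => ?_)) this
    ring
  refine ⟨u, fun j hj => ?_, fun j hj => ?_, ?_⟩
  · have := hcol j
    rw [hj] at this
    linarith
  · have := hcol j
    rw [hj] at this
    linarith
  · have := hu (.inr ())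
    simp only [vecMul, dotProduct, of_apply, Sum.elim_inr, mul_neg, Finset.sum_neg_distrib] at this
    simp only [dotProduct]
    linarith

/-- In an optimal solution of `P(k + 1)` every agent can be avoided by a binary solution of `P(k)`
whose agents are among those of the given solution. -/
theorem exists_binary_avoiding (P : SetAuction m n)
    (hTU : P.extendedMatrix.IsTotallyUnimodular) {k : ℕ} {xb : n → ℝ}
    (hxb : P.IsFeasible ((k : ℝ) + 1) xb) (hxb_bin : IsBinary xb) (j : n) :
    ∃ x, P.IsFeasible k x ∧ IsBinary x ∧ x j = 0 ∧ ∀ i, xb i = 0 → x i = 0 := by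
  classical
  have hk : (0 : ℝ) < (k : ℝ) + 1 := by positivity
  have hfeas : P.IsFeasible ((1 : ℕ) : ℝ) (((k : ℝ) + 1)⁻¹ • xb) := by
    refine ⟨?_, fun i => ?_⟩
    · rw [mulVec_smul, hxb.1, smul_smul, inv_mul_cancel₀ hk.ne', Nat.cast_one]
    · simp only [Pi.smul_apply, smul_eq_mul]
      refine ⟨mul_nonneg (inv_nonneg.2 hk.le) (hxb.2 i).1, ?_⟩
      rw [inv_mul_le_iff₀ hk]
      have := (hxb.2 i).2
      have : (0 : ℝ) ≤ k := k.cast_nonneg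
      linarith
  -- Rewarding j makes the binary P(1)-solution y use j whenever `xb` does, so `xb - y` avoids j.
  obtain ⟨y, hy, hyb, hy₀, hyle⟩ := P.exists_binary_le hTU hfeas (-Pi.single j 1)
  have hle : ((k : ℝ) + 1)⁻¹ * xb j ≤ y j := by simpa using hyle
  have hzero : ∀ i, xb i = 0 → y i = 0 := fun i hi => hy₀ i (by simp [hi])
  have hbin : IsBinary (xb - y) := fun i => by
    rcases hxb_bin i with h | h
    · simp [h, hzero i h]
    · rcases hyb i with h' | h' <;> simp [h, h']
  refine ⟨xb - y, ⟨?_, fun i => ?_⟩, hbin, ?_, fun i hi => ?_⟩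
  · rw [mulVec_sub, hxb.1, hy.1, ← sub_smul]
    simp
  · rcases hbin i with h | h <;> simp [h]
  · rcases hxb_bin j with h | h
    · simp [h, hzero j h]
    · rw [h, mul_one] at hle
      have hpos : 0 < y j := lt_of_lt_of_le (inv_pos.2 hk) hle
      rcases hyb j with h' | h'
      · exact absurd h' hpos.ne'
      · simp [h, h']
  · simp [hi, hzero i hi]

theorem mem_benchmarkValues [Fintype m] (P : SetAuction m n)
    (hTU : P.extendedMatrix.IsTotallyUnimodular) {k : ℕ} {xs xb : n → ℝ}
    (hxs : P.IsOptimal k xs) (hxs_bin : IsBinary xs) (hxb : P.IsOptimal ((k : ℝ) + 1) xb)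
    (hxb_bin : IsBinary xb) :
    k * (P.c ⬝ᵥ xb - P.c ⬝ᵥ xs) ∈ P.benchmarkValues k xs := by
  obtain ⟨u, hu₁, hu₀, hub⟩ := P.exists_potential hTU hxs hxs_bin hxb
  have hu : ∀ t x, P.IsFeasible t x → (u ᵥ* P.A) ⬝ᵥ x = t * (u ⬝ᵥ P.b) := fun t x hx => by
    rw [← dotProduct_mulVec, hx.1, dotProduct_smul, smul_eq_mul]
  have hterm : ∀ j, 0 ≤ (P.c j - (u ᵥ* P.A) j) * (xb j - xs j) := fun j => by
    rcases hxs_bin j with h | h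
    · rw [h, sub_zero]
      exact mul_nonneg (sub_nonneg.2 (hu₀ j h)) (hxb.1.2 j).1
    · rw [h]
      exact mul_nonneg_of_nonpos_of_nonpos (sub_nonpos.2 (hu₁ j h))
        (sub_nonpos.2 (hxb.1.2 j).2)
  have hsum : ∑ j, (P.c j - (u ᵥ* P.A) j) * (xb j - xs j) =
      (P.c ⬝ᵥ xb - P.c ⬝ᵥ xs) - u ⬝ᵥ P.b := by
    have h₁ := hu _ _ hxs.1
    have h₂ := hu _ _ hxb.1
    have : ∑ j, (P.c j - (u ᵥ* P.A) j) * (xb j - xs j) =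
        (P.c ⬝ᵥ xb - P.c ⬝ᵥ xs) - ((u ᵥ* P.A) ⬝ᵥ xb - (u ᵥ* P.A) ⬝ᵥ xs) := by
      simp only [dotProduct, ← Finset.sum_sub_distrib]
      exact Finset.sum_congr rfl fun j _ => by ring
    rw [this, h₁, h₂]
    ring
  have hnonneg := Finset.sum_nonneg fun j (_ : j ∈ Finset.univ) => hterm j
  have hδ : u ⬝ᵥ P.b = P.c ⬝ᵥ xb - P.c ⬝ᵥ xs := by linarith
  -- Complementary slackness: nonnegative terms with sum δ - u·b ≤ 0 all vanish.
  have hslack : ∀ j, xs j = 0 → xb j = 1 → P.c j = (u ᵥ* P.A) j := fun j h₀ h₁ => by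
    have := (Finset.sum_eq_zero_iff_of_nonneg fun j _ => hterm j).1
      (by rw [hsum, hδ, sub_self]) j (Finset.mem_univ j)
    rw [h₀, h₁] at this
    linarith
  let z : n → ℝ := fun j => max (P.c j) ((u ᵥ* P.A) j)
  have hz₁ : ∀ j, xs j = 1 → z j = (u ᵥ* P.A) j := fun j hj => max_eq_right (hu₁ j hj)
  have hz₀ : ∀ j, xs j = 0 → z j = P.c j := fun j hj => max_eq_left (hu₀ j hj)
  have hzxs : z ⬝ᵥ xs = k * (u ⬝ᵥ P.b) := by
    rw [← hu _ _ hxs.1]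
    refine Finset.sum_congr rfl fun j _ => ?_
    rcases hxs_bin j with h | h
    · simp [h]
    · rw [hz₁ j h]
  refine ⟨z, ⟨fun j _ => le_max_left _ _, hz₀, fun x hx _ => ?_, fun j => ?_⟩, ?_⟩
  · rw [hzxs, ← hu _ _ hx]
    exact Finset.sum_le_sum fun j _ => mul_le_mul_of_nonneg_right (le_max_right _ _) (hx.2 j).1
  · obtain ⟨x, hx, hxbin, hxj, hsupp⟩ := P.exists_binary_avoiding hTU hxb.1 hxb_bin j
    refine ⟨x, hx, hxbin, hxj, ?_⟩
    rw [hzxs, ← hu _ _ hx]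
    refine Finset.sum_congr rfl fun i _ => ?_
    rcases hxs_bin i with h | h
    · rcases hxb_bin i with h' | h'
      · simp [hsupp i h']
      · rw [hz₀ i h, hslack i h h']
    · rw [hz₁ i h]
  · rw [← dotProduct_eq_sum_winners hxs_bin, hzxs, hδ]

/-! ### Upper bound on benchmark prices. -/

/-- Stability of benchmark prices extends to fractional solutions. -/
theorem IsBenchmarkPrice.stable_fractional {P : SetAuction m n}
    (hTU : P.extendedMatrix.IsTotallyUnimodular) {k : ℕ} {xs z : n → ℝ}
    (hz : P.IsBenchmarkPrice k xs z) {x : n → ℝ} (hx : P.IsFeasible k x) :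
    z ⬝ᵥ xs ≤ z ⬝ᵥ x := by
  obtain ⟨y, hy, hyb, -, hle⟩ := P.exists_binary_le hTU hx z
  exact (hz.stable y hy hyb).trans hle

/-- Averaging the tight solutions gives an optimal fractional solution without saturated
agents. -/
theorem IsBenchmarkPrice.exists_unsaturated {P : SetAuction m n} {t : ℝ} {xs z : n → ℝ}
    (hz : P.IsBenchmarkPrice t xs z) (hxs : P.IsFeasible t xs) :
    ∃ x, P.A *ᵥ x = t • P.b ∧ z ⬝ᵥ x = z ⬝ᵥ xs ∧
      ∀ j, 0 ≤ x j ∧ x j + ((Fintype.card n : ℝ) + 1)⁻¹ ≤ 1 := by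
  choose y hy hyb hyj hyz using hz.tight
  have hN : (0 : ℝ) < (Fintype.card n : ℝ) + 1 := by positivity
  -- Of the card n + 1 averaged points, `y j` vanishes at j, which leaves the slack.
  refine ⟨((Fintype.card n : ℝ) + 1)⁻¹ • (xs + ∑ i, y i), ?_, ?_, fun j => ⟨?_, ?_⟩⟩
  · rw [mulVec_smul, mulVec_add, mulVec_sum, hxs.1,
      Finset.sum_congr rfl fun i _ => (hy i).1, Finset.sum_const, Finset.card_univ,
      inv_smul_eq_iff₀ hN.ne', add_smul, one_smul, add_comm, Nat.cast_smul_eq_nsmul]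
  · rw [dotProduct_smul, dotProduct_add, dotProduct_sum,
      Finset.sum_congr rfl fun i _ => (hyz i).symm, Finset.sum_const, Finset.card_univ,
      inv_smul_eq_iff₀ hN.ne', add_smul, one_smul, add_comm, Nat.cast_smul_eq_nsmul]
  · simp only [Pi.smul_apply, Pi.add_apply, Finset.sum_apply, smul_eq_mul]
    exact mul_nonneg (inv_nonneg.2 hN.le)
      (add_nonneg (hxs.2 j).1 (Finset.sum_nonneg fun i _ => ((hy i).2 j).1))
  · simp only [Pi.smul_apply, Pi.add_apply, Finset.sum_apply, smul_eq_mul]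
    have hsum : ∑ i, y i j + 1 ≤ Fintype.card n := by
      classical
      rw [← Finset.add_sum_erase _ _ (Finset.mem_univ j), hyj, zero_add]
      have := Finset.sum_le_card_nsmul (Finset.univ.erase j) (fun i => y i j) 1
        fun i _ => ((hy i).2 j).2
      rw [nsmul_one, Finset.card_erase_of_mem (Finset.mem_univ j), Finset.card_univ,
        Nat.cast_sub (Fintype.card_pos_iff.2 ⟨j⟩)] at this
      push_cast at this
      linarith
    have h₁ := (hxs.2 j).2
    rw [← mul_add_one, inv_mul_le_iff₀ hN]
    linarith

/-- Stability along `xb` - ((k+1)/k) x gives z·`xs` ≤ k (z·`xb` - z·`xs`). Replacing z by c only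
enlarges the difference, since z exceeds c only on winners, where `xb` ≤ `xs`. -/
theorem benchmarkValues_le (P : SetAuction m n)
    (hTU : P.extendedMatrix.IsTotallyUnimodular) {k : ℕ} (hk : 0 < k) {xs xb : n → ℝ}
    (hxs : P.IsOptimal k xs) (hxs_bin : IsBinary xs) (hxb : P.IsOptimal ((k : ℝ) + 1) xb) :
    k * (P.c ⬝ᵥ xb - P.c ⬝ᵥ xs) ∈ upperBounds (P.benchmarkValues k xs) := by
  rintro _ ⟨z, hz, rfl⟩
  rw [← dotProduct_eq_sum_winners hxs_bin]
  obtain ⟨x, hAx, hzx, hx⟩ := hz.exists_unsaturated hxs.1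
  have hk₁ : (1 : ℝ) ≤ k := by exact_mod_cast hk
  have hk₀ : (0 : ℝ) < k := by linarith
  have hN : (0 : ℝ) < (Fintype.card n : ℝ) + 1 := by positivity
  -- At most the slack of x below 1; the half offsets (k+1)/k ≤ 2, preserving nonnegativity.
  let ε : ℝ := ((Fintype.card n : ℝ) + 1)⁻¹ / 2
  have hε : 0 < ε := by positivity
  have hε₁ : ε * (((k : ℝ) + 1) / k) ≤ 1 := by
    have h₁ : ((Fintype.card n : ℝ) + 1)⁻¹ ≤ 1 := inv_le_one_of_one_le₀ (by simp)
    have h₂ : ((k : ℝ) + 1) / k ≤ 2 := by rw [div_le_iff₀ hk₀]; linarith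
    have h₃ : ε ≤ 1 / 2 := by simp only [ε]; linarith
    have := mul_le_mul h₃ h₂ (by positivity) (by norm_num)
    linarith
  have hfeas : P.IsFeasible k (x + ε • (xb - (((k : ℝ) + 1) / k) • x)) := by
    refine ⟨?_, fun j => ?_⟩
    · rw [mulVec_add, mulVec_smul, mulVec_sub, mulVec_smul, hxb.1.1, hAx, smul_smul,
        div_mul_cancel₀ _ hk₀.ne', sub_self, smul_zero, add_zero]
    · simp only [Pi.add_apply, Pi.smul_apply, Pi.sub_apply, smul_eq_mul]
      obtain ⟨hx₀, hx₁⟩ := hx j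
      obtain ⟨hb₀, hb₁⟩ := hxb.1.2 j
      have h₁ := mul_le_mul_of_nonneg_right hε₁ hx₀
      have h₂ := mul_nonneg hε.le hb₀
      have h₃ : ε * xb j ≤ ((Fintype.card n : ℝ) + 1)⁻¹ := by
        have := mul_le_mul_of_nonneg_left hb₁ hε.le
        have h₄ : ε * 1 ≤ ((Fintype.card n : ℝ) + 1)⁻¹ := by
          have := inv_pos.2 hN
          simp only [ε]; linarith
        linarith
      have h₄ : 0 ≤ ε * (((k : ℝ) + 1) / k * x j) := by positivity
      constructor <;> linarith
  have hst := hz.stable_fractional hTU hfeas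
  rw [dotProduct_add, dotProduct_smul, dotProduct_sub, dotProduct_smul, hzx, smul_eq_mul,
    smul_eq_mul] at hst
  have hslope : ((k : ℝ) + 1) / k * (z ⬝ᵥ xs) ≤ z ⬝ᵥ xb := by
    have : 0 ≤ ε * (z ⬝ᵥ xb - ((k : ℝ) + 1) / k * (z ⬝ᵥ xs)) := by linarith
    linarith [nonneg_of_mul_nonneg_right this hε]
  rw [div_mul_eq_mul_div, div_le_iff₀ hk₀] at hslope
  have hdiff : z ⬝ᵥ xb - z ⬝ᵥ xs ≤ P.c ⬝ᵥ xb - P.c ⬝ᵥ xs := by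
    simp only [dotProduct, ← Finset.sum_sub_distrib]
    refine Finset.sum_le_sum fun j _ => ?_
    rcases hxs_bin j with h | h
    · rw [hz.losers j h]
    · rw [← mul_sub, ← mul_sub, h]
      exact mul_le_mul_of_nonpos_right (hz.winners j h) (sub_nonpos.2 (hxb.1.2 j).2)
  have := mul_le_mul_of_nonneg_left hdiff hk₀.le
  linarith

/-- The value of the max benchmark problem of `P(k)` is `k` times the increase of the optimal
value from `P(k)` to `P(k + 1)`. -/
theorem isGreatest_benchmarkValues [Fintype m] (P : SetAuction m n)
    (hTU : P.extendedMatrix.IsTotallyUnimodular) {k : ℕ} (hk : 0 < k) {xs xb : n → ℝ}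
    (hxs : P.IsOptimal k xs) (hxs_bin : IsBinary xs) (hxb : P.IsOptimal ((k : ℝ) + 1) xb)
    (hxb_bin : IsBinary xb) :
    IsGreatest (P.benchmarkValues k xs) (k * (P.c ⬝ᵥ xb - P.c ⬝ᵥ xs)) :=
  ⟨P.mem_benchmarkValues hTU hxs hxs_bin hxb hxb_bin, P.benchmarkValues_le hTU hk hxs hxs_bin hxb⟩

/-! ### The pruned auction and the final comparison. -/

open Classical in
theorem sum_pruned (x : n → ℝ) (a : n → ℝ) (y : {j : n // x j = 1} → ℝ) :
    ∑ j, a j * (if h : x j = 1 then y ⟨j, h⟩ else 0) = ∑ j : {j : n // x j = 1}, a j * y j := by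
  rw [← Fintype.sum_subtype_add_sum_subtype (fun j => x j = 1)]
  have h₀ : ∑ j : {j : n // ¬ x j = 1}, a j * (if h : x j = 1 then y ⟨j, h⟩ else 0) = 0 :=
    Finset.sum_eq_zero fun j _ => by rw [dif_neg j.2, mul_zero]
  rw [h₀, add_zero]
  refine Finset.sum_congr (by ext; simp) fun j _ => ?_
  rw [dif_pos j.2]

/-- A feasible solution of the pruned auction extends to one of the auction at the same cost. -/
theorem exists_isFeasible_of_pruned (P : SetAuction m n) {x : n → ℝ} {t : ℝ}
    {y : {j : n // x j = 1} → ℝ} (hy : (P.pruned x).IsFeasible t y) :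
    ∃ w, P.IsFeasible t w ∧ P.c ⬝ᵥ w = (P.pruned x).c ⬝ᵥ y := by
  classical
  refine ⟨fun j => if h : x j = 1 then y ⟨j, h⟩ else 0, ⟨?_, fun j => ?_⟩, sum_pruned x P.c y⟩
  · rw [← show _ = t • P.b from hy.1]
    ext i
    exact sum_pruned x (P.A i) y
  · by_cases h : x j = 1
    · simpa [h] using hy.2 ⟨j, h⟩
    · simp [h]

theorem pruned_mulVec_const (P : SetAuction m n) {x : n → ℝ} (hx : IsBinary x) (r : ℝ) :
    (P.pruned x).A *ᵥ (fun _ => r) = r • (P.A *ᵥ x) := by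
  ext i
  have := sum_pruned x (P.A i) fun _ => r
  rw [Pi.smul_apply, smul_eq_mul]
  refine this.symm.trans ?_
  rw [mulVec, dotProduct, Finset.mul_sum]
  refine Finset.sum_congr rfl fun j _ => ?_
  rcases hx j with h | h <;> simp [h, mul_comm]

theorem pruned_dotProduct_const (P : SetAuction m n) {x : n → ℝ} (hx : IsBinary x) (r : ℝ) :
    (P.pruned x).c ⬝ᵥ (fun _ => r) = r * (P.c ⬝ᵥ x) := by
  have := sum_pruned x P.c fun _ => r
  refine this.symm.trans ?_
  rw [dotProduct, Finset.mul_sum]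
  refine Finset.sum_congr rfl fun j _ => ?_
  rcases hx j with h | h <;> simp [h, mul_comm]

theorem pruned_isFeasible_const (P : SetAuction m n) {x : n → ℝ} (hx : IsBinary x) {t r : ℝ}
    (hfeas : P.IsFeasible t x) (hr₀ : 0 ≤ r) (hr₁ : r ≤ 1) :
    (P.pruned x).IsFeasible (r * t) fun _ => r := by
  refine ⟨?_, fun _ => ⟨hr₀, hr₁⟩⟩
  rw [P.pruned_mulVec_const hx, hfeas.1, smul_smul]
  rfl

theorem pruned_isOptimal_one (P : SetAuction m n) {x : n → ℝ} (hx : IsBinary x) {t : ℝ}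
    (hopt : P.IsOptimal t x) : (P.pruned x).IsOptimal t fun _ => 1 := by
  refine ⟨by simpa using P.pruned_isFeasible_const hx hopt.1 zero_le_one le_rfl, fun y hy => ?_⟩
  obtain ⟨w, hw, hcw⟩ := P.exists_isFeasible_of_pruned hy
  rw [P.pruned_dotProduct_const hx, one_mul, ← hcw]
  exact hopt.2 w hw

end SetAuction

theorem theorem2 {m n : Type*} [Fintype m] [Fintype n] (P : SetAuction m n)
    (hTU : P.extendedMatrix.IsTotallyUnimodular) (hb : P.b ≠ 0) (hc : ∀ j, 0 ≤ P.c j)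
    (k : ℕ) (hk : 0 < k) (hmono : P.MonopolyFree (k : ℝ))
    (xs : n → ℝ) (hxs : P.IsOptimal (k : ℝ) xs) (hxs_bin : SetAuction.IsBinary xs)
    (xb : n → ℝ) (hxb : P.IsOptimal ((k : ℝ) + 1) xb) (hxb_bin : SetAuction.IsBinary xb) :
    ∃ μ μt : ℝ,
      IsGreatest (P.benchmarkValues (k : ℝ) xs) μ ∧
      (∃ xt, (P.pruned xb).IsOptimal (k : ℝ) xt ∧ SetAuction.IsBinary xt) ∧
      (∀ xt, (P.pruned xb).IsOptimal (k : ℝ) xt → SetAuction.IsBinary xt →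
        IsGreatest ((P.pruned xb).benchmarkValues (k : ℝ) xt) μt) ∧
      μt ≤ μ ∧ μ ≤ ((k : ℝ) + 1) * μt := by
  have hk₀ : (0 : ℝ) ≤ k := k.cast_nonneg
  have hk₁ : (0 : ℝ) < (k : ℝ) + 1 := by positivity
  have hTU' := P.pruned_isTotallyUnimodular hTU xb
  have hfrac : (P.pruned xb).IsFeasible k fun _ => (k : ℝ) / (k + 1) := by
    have := P.pruned_isFeasible_const hxb_bin hxb.1 (r := (k : ℝ) / (k + 1)) (by positivity)
      ((div_le_one hk₁).2 (by linarith))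
    rwa [div_mul_cancel₀ _ hk₁.ne'] at this
  obtain ⟨xt, hxt, hxt_bin⟩ := (P.pruned xb).exists_binary_isOptimal hTU' ⟨_, hfrac⟩
  refine ⟨k * (P.c ⬝ᵥ xb - P.c ⬝ᵥ xs), k * (P.c ⬝ᵥ xb - (P.pruned xb).c ⬝ᵥ xt),
    P.isGreatest_benchmarkValues hTU hk hxs hxs_bin hxb hxb_bin, ⟨xt, hxt, hxt_bin⟩,
    fun y hy hy_bin => ?_, ?_, ?_⟩
  · have := (P.pruned xb).isGreatest_benchmarkValues hTU' hk hy hy_bin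
      (P.pruned_isOptimal_one hxb_bin hxb) fun _ => Or.inr rfl
    rwa [P.pruned_dotProduct_const hxb_bin, one_mul,
      le_antisymm (hy.2 xt hxt.1) (hxt.2 y hy.1)] at this
  · obtain ⟨w, hw, hcw⟩ := P.exists_isFeasible_of_pruned hxt.1
    have := hxs.2 w hw
    exact mul_le_mul_of_nonneg_left (by linarith) hk₀
  -- The constant solution gives c·`xt` ≤ (k/(k+1)) c·`xb`, hence c·`xb` ≤ (k+1)(c·`xb` - c·`xt`);
  -- dropping c·`xs` ≥ 0 finishes.
  · have hle := hxt.2 _ hfrac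
    rw [P.pruned_dotProduct_const hxb_bin, div_mul_eq_mul_div, le_div_iff₀ hk₁] at hle
    have hxs₀ : 0 ≤ P.c ⬝ᵥ xs := Finset.sum_nonneg fun j _ => mul_nonneg (hc j) (hxs.1.2 j).1
    rw [mul_left_comm]
    exact mul_le_mul_of_nonneg_left (by linarith) hk₀
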